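/- For real $u>0$ let $\zeta(s,u)$ denote the Hurwitz zeta function, i.e. the analytic continuation in $s$ of $\sum_{n=0}^{\infty}(n+u)^{-s}$ ($\operatorname{Re} s>1$), and let the generalised Stieltjes constants $\gamma_p(u)$, $p\ge 0$, be defined by its Laurent expansion about $s=1$, $$\zeta(s,u)=\frac{1}{s-1}+\sum_{p=0}^{\infty}\frac{(-1)^p}{p!}\,\gamma_p(u)\,(s-1)^p .$$ Write $\gamma_1=\gamma_1(1)$ for the first Stieltjes constant (belonging to $\zeta(s)=\zeta(s,1)$), let $\gamma$ be Euler's constant and $\Gamma$ the gamma function. Then $$\gamma_1\left(\tfrac13\right)-\gamma_1\left(\tfrac23\right)=-\frac{\pi}{2\sqrt3}\left[2\gamma-\log 3+8\log(2\pi)-12\log\Gamma\left(\tfrac13\right)\right];$$ equivalently, $$\gamma_1\left(\tfrac13\right)-\gamma_1\left(\tfrac23\right)=\frac{\pi}{\sqrt3}\left[6\log\Gamma\left(\tfrac13\right)+\tfrac12\log 3-\bigl(\gamma+4\log(2\pi)\bigr)\right].$$ Moreover $$\gamma_1\left(\tfrac13\right)+\gamma_1\left(\tfrac23\right)=2\gamma_1-3\gamma\log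 3-\tfrac32\log^2 3,$$ and hence $$\gamma_1\left(\tfrac13\right)=\gamma_1-\tfrac32\gamma\log 3-\tfrac34\log^2 3-\frac{\pi}{4\sqrt3}\left[2\gamma-\log 3+8\log(2\pi)-12\log\Gamma\left(\tfrac13\right)\right],$$ $$\gamma_1\left(\tfrac23\right)=\gamma_1-\tfrac32\gamma\log 3-\tfrac34\log^2 3+\frac{\pi}{4\sqrt3}\left[2\gamma-\log 3+8\log(2\pi)-12\log\Gamma\left(\tfrac13\right)\right].$$ -/

import Mathlib

open Complex Filter Topology

/-- The Hurwitz zeta function `ζ(s, u)` for a real parameter `u > 0`: the analytic continuation in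
`s` of the series `∑ (n : ℕ), 1 / (n + u) ^ s`, which converges for `1 < re s` (see
`hasSum_hurwitzZetaReal`). Mathlib's `HurwitzZeta.hurwitzZeta` is periodic in its parameter and is
the Hurwitz zeta function for the representative `a ∈ (0, 1]` of `u` modulo `1`; writing
`u = m + a` with `m = ⌈u⌉₊ - 1`, we subtract the first `m` terms `1 / (a + k) ^ s`, `k < m`.
For `u ∈ (0, 1]` there is nothing to subtract. -/
noncomputable def hurwitzZetaReal (s : ℂ) (u : ℝ) : ℂ :=
  HurwitzZeta.hurwitzZeta (u : UnitAddCircle) s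
    - ∑ k ∈ Finset.range (⌈u⌉₊ - 1), 1 / ((k : ℂ) + ((u - (⌈u⌉₊ - 1 : ℕ) : ℝ) : ℂ)) ^ s

/-- The regular part `ζ(s, u) - 1 / (s - 1)` of the Hurwitz zeta function at its pole `s = 1`, the
removable singularity at `s = 1` being removed by taking the limit there. -/
noncomputable def hurwitzRegularPart (u : ℝ) : ℂ → ℂ :=
  Function.update (fun s ↦ hurwitzZetaReal s u - 1 / (s - 1)) 1
    (limUnder (𝓝[≠] 1) fun s ↦ hurwitzZetaReal s u - 1 / (s - 1))

/-- The generalised Stieltjes constant `γ_p(u)`, `u > 0`, defined by the Laurent expansion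
`ζ(s, u) = 1 / (s - 1) + ∑ p, (-1) ^ p / p! * γ_p(u) * (s - 1) ^ p` about `s = 1`, that is,
`(-1) ^ p` times the `p`-th Taylor derivative at `1` of the regular part
(see `hasSum_generalisedStieltjes`). -/
noncomputable def generalisedStieltjes (p : ℕ) (u : ℝ) : ℂ :=
  (-1) ^ p * iteratedDeriv p (hurwitzRegularPart u) 1

/-- The Stieltjes constant `γ_p = γ_p(1)`, from the Laurent expansion of the Riemann zeta function
`ζ(s) = ζ(s, 1)` about `s = 1` (see `hurwitzZetaReal_one`). -/
noncomputable def stieltjesConstant (p : ℕ) : ℂ := generalisedStieltjes p 1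

/-! Checks that the definitions are the intended objects. -/

theorem hurwitzZetaReal_of_le_one (s : ℂ) {u : ℝ} (hu : u ≤ 1) :
    hurwitzZetaReal s u = HurwitzZeta.hurwitzZeta (u : UnitAddCircle) s := by
  have : ⌈u⌉₊ - 1 = 0 := by
    have : ⌈u⌉₊ ≤ 1 := Nat.ceil_le.2 (by simpa using hu)
    omega
  simp [hurwitzZetaReal, this]

theorem hurwitzZetaReal_one (s : ℂ) : hurwitzZetaReal s 1 = riemannZeta s := by
  rw [hurwitzZetaReal_of_le_one s le_rfl, ← HurwitzZeta.hurwitzZeta_zero]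
  congr 1
  exact AddCircle.coe_period 1

theorem hasSum_hurwitzZetaReal {u : ℝ} (hu : 0 < u) {s : ℂ} (hs : 1 < s.re) :
    HasSum (fun n : ℕ ↦ 1 / ((n : ℂ) + (u : ℂ)) ^ s) (hurwitzZetaReal s u) := by
  obtain ⟨m, hm⟩ : ∃ m, ⌈u⌉₊ = m + 1 :=
    ⟨⌈u⌉₊ - 1, by have := Nat.ceil_pos.2 hu; omega⟩
  have h1 : (m : ℝ) < u := Nat.lt_ceil.1 (by omega)
  have h2 : u ≤ m + 1 := by simpa [hm] using Nat.le_ceil u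
  have hcoe : ((u - m : ℝ) : UnitAddCircle) = (u : UnitAddCircle) := by
    have h := AddCircle.coe_period (1 : ℝ)
    have h' : ((m : ℝ) : UnitAddCircle) = 0 := by
      have := congrArg (fun x ↦ m • x) h
      simpa [← AddCircle.coe_nsmul] using this
    rw [AddCircle.coe_sub, h', sub_zero]
  have h := HurwitzZeta.hasSum_hurwitzZeta_of_one_lt_re (a := u - m)
    ⟨by linarith, by linarith⟩ hs
  rw [hcoe] at h
  rw [← hasSum_nat_add_iff' m] at h
  simp only [hurwitzZetaReal, hm, Nat.add_sub_cancel]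
  refine h.congr_fun fun n ↦ ?_
  push_cast
  ring_nf

theorem differentiable_hurwitzRegularPart {u : ℝ} (hu : 0 < u) :
    Differentiable ℂ (hurwitzRegularPart u) := by
  have hm : (((⌈u⌉₊ - 1 : ℕ) : ℕ) : ℝ) < u :=
    Nat.lt_ceil.1 (by have := Nat.ceil_pos.2 hu; omega)
  have hsum : Differentiable ℂ fun s : ℂ ↦ ∑ k ∈ Finset.range (⌈u⌉₊ - 1),
      1 / ((k : ℂ) + ((u - (⌈u⌉₊ - 1 : ℕ) : ℝ) : ℂ)) ^ s := by
    refine Differentiable.fun_sum fun k _ ↦ ?_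
    have hne : (k : ℂ) + ((u - (⌈u⌉₊ - 1 : ℕ) : ℝ) : ℂ) ≠ 0 := by
      have : (k : ℝ) + (u - (⌈u⌉₊ - 1 : ℕ)) ≠ 0 :=
        (add_pos_of_nonneg_of_pos k.cast_nonneg (sub_pos.2 hm)).ne'
      exact_mod_cast this
    intro s
    exact (differentiableAt_const _).div (differentiableAt_id.const_cpow (Or.inl hne))
      (fun h ↦ hne (Complex.cpow_eq_zero_iff _ _ |>.1 h).1)
  have hd : DifferentiableOn ℂ (fun s ↦ hurwitzZetaReal s u - 1 / (s - 1)) (Set.univ \ {1}) := by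
    intro s hs
    have hs' : s ≠ 1 := by simpa using hs
    refine DifferentiableAt.differentiableWithinAt ?_
    exact ((HurwitzZeta.differentiableAt_hurwitzZeta _ hs').sub (hsum s)).sub
      ((differentiableAt_const _).div (by fun_prop) (sub_ne_zero.2 hs'))
  rw [← differentiableOn_univ]
  refine differentiableOn_update_limUnder_of_isLittleO Filter.univ_mem hd ?_
  have hsub : Tendsto (fun s : ℂ ↦ s - 1) (𝓝[≠] 1) (𝓝 0) := by
    have : Tendsto (fun s : ℂ ↦ s - 1) (𝓝 1) (𝓝 (1 - 1)) := tendsto_id.sub_const 1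
    simpa using this.mono_left nhdsWithin_le_nhds
  refine Asymptotics.isLittleO_of_tendsto' ?_ ?_
  · filter_upwards [self_mem_nhdsWithin] with s hs h
    exact absurd h (inv_ne_zero (sub_ne_zero.2 hs))
  · have h1 := (HurwitzZeta.hurwitzZeta_residue_one (u : UnitAddCircle)).sub
      (hsub.mul ((hsum.continuous.tendsto 1).mono_left nhdsWithin_le_nhds))
    have h2 := (h1.sub_const 1).sub (hsub.mul_const (hurwitzZetaReal 1 u - 1 / (1 - 1)))
    simp only [zero_mul, sub_zero, sub_self] at h2
    refine h2.congr' ?_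
    filter_upwards [self_mem_nhdsWithin] with s hs
    have hs' : s - 1 ≠ 0 := sub_ne_zero.2 hs
    simp only [hurwitzZetaReal, div_inv_eq_mul]
    field_simp
    ring

theorem hasSum_generalisedStieltjes {u : ℝ} (hu : 0 < u) {s : ℂ} (hs : s ≠ 1) :
    HasSum (fun p : ℕ ↦ (-1) ^ p / (p.factorial : ℂ) * generalisedStieltjes p u * (s - 1) ^ p)
      (hurwitzZetaReal s u - 1 / (s - 1)) := by
  have h := Complex.hasSum_taylorSeries_of_entire (differentiable_hurwitzRegularPart hu) 1 s
  rw [show hurwitzRegularPart u s = hurwitzZetaReal s u - 1 / (s - 1) by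
    simp [hurwitzRegularPart, hs]] at h
  refine h.congr_fun fun p ↦ ?_
  have hp : ((-1 : ℂ) ^ p) * (-1) ^ p = 1 := by rw [← mul_pow]; simp
  simp only [generalisedStieltjes, smul_eq_mul]
  linear_combination ((p.factorial : ℂ)⁻¹ * (s - 1) ^ p *
    iteratedDeriv p (hurwitzRegularPart u) 1) * hp

/-! In `D(s) = ζ(s, 1/3) - ζ(s, 2/3)` the poles cancel, so `D` is entire and `γ_1(1/3) - γ_1(2/3) =
-D'(1)`. The functional equation of the odd Hurwitz zeta function, closed up by the Fourier
transform modulo 3, relates `D(1 - s)` to `D(s)` (`hurwitzThirdsDiff_one_sub`). Differentiated at `s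
= 1`, it gives `D'(1)` from `D(0)` and `D'(0)`. These come from a series for `ζ(s, a) - ζ(s, b)`
valid near `0`: the value there is `b - a`, and the derivative is `log Γ(a) - log Γ(b)` by Euler's
limit for `Γ` (Lerch's formula). Reflection eliminates `Γ(2/3)`.

For the sum, sorting the integers modulo 3 gives `ζ(s) + ζ(s, 1/3) + ζ(s, 2/3) = 3 ^ s ζ(s)`. In
terms of regular parts this is `sub_one_mul_hurwitzThirdsDefect`; comparing first derivatives at `1`
yields the sum, with `γ` entering as the value of the regular part of `ζ`. Half the sum and
difference of the two results give the individual values. -/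

/-! ### A series for `ζ(s, a) - ζ(s, b)` near `s = 0` -/

theorem norm_ofReal_cpow_neg_sub_le {m x y : ℝ} (hm : 0 < m) (hx : m ≤ x) (hy : m ≤ y) {w : ℂ}
    (hw : -1 ≤ w.re) :
    ‖(x : ℂ) ^ (-w) - (y : ℂ) ^ (-w)‖ ≤ ‖w‖ * m ^ (-w.re - 1) * |x - y| := by
  rcases eq_or_ne w 0 with rfl | hw0
  · simp
  have hd : ∀ t ∈ Set.Ici m, HasDerivWithinAt (fun t : ℝ ↦ (t : ℂ) ^ (-w))
      (-w * (t : ℂ) ^ (-w - 1)) (Set.Ici m) t := fun t ht ↦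
    (hasDerivAt_ofReal_cpow_const (hm.trans_le ht).ne' (neg_ne_zero.2 hw0)).hasDerivWithinAt
  have := Convex.norm_image_sub_le_of_norm_hasDerivWithin_le (C := ‖w‖ * m ^ (-w.re - 1)) hd
    (fun t ht ↦ ?_) (convex_Ici m) (y := x) (x := y) hy hx
  · simpa using this
  · rw [norm_mul, norm_neg, norm_cpow_eq_rpow_re_of_pos (hm.trans_le ht)]
    gcongr
    simpa using Real.rpow_le_rpow_of_nonpos hm ht (by linarith : -w.re - 1 ≤ 0)

/-- The summand of a series for `ζ(s, a) - ζ(s, b)` that converges for `-1 < re s`. -/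
noncomputable def hurwitzDiffTerm (a b : ℝ) (n : ℕ) (s : ℂ) : ℂ :=
  ((n + a : ℝ) : ℂ) ^ (-s) - ((n + b : ℝ) : ℂ) ^ (-s)
    - (b - a) * (((n + 1 : ℝ) : ℂ) ^ (-s) - ((n + 2 : ℝ) : ℂ) ^ (-s))

theorem hasDerivAt_hurwitzDiffTerm {a b : ℝ} (ha : 0 < a) (hb : 0 < b) (n : ℕ) (s : ℂ) :
    HasDerivAt (hurwitzDiffTerm a b n)
      (-(((n + a : ℝ) : ℂ) ^ (-s) * Real.log (n + a) - ((n + b : ℝ) : ℂ) ^ (-s) * Real.log (n + b)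
        - (b - a) * (((n + 1 : ℝ) : ℂ) ^ (-s) * Real.log (n + 1)
          - ((n + 2 : ℝ) : ℂ) ^ (-s) * Real.log (n + 2)))) s := by
  have key : ∀ x : ℝ, 0 < x → HasDerivAt (fun s : ℂ ↦ (x : ℂ) ^ (-s))
      (-((x : ℂ) ^ (-s) * Real.log x)) s := fun x hx ↦ by
    have := (hasDerivAt_neg s).const_cpow (c := (x : ℂ)) (Or.inl (by exact_mod_cast hx.ne'))
    rw [ofReal_log hx.le]
    convert this using 1
    ring
  exact (((key (n + a) (by positivity)).sub (key (n + b) (by positivity))).sub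
    (((key (n + 1) (by positivity)).sub (key (n + 2) (by positivity))).const_mul
      ((b : ℂ) - a))).congr_deriv (by ring)

/-- The telescoping correction cancels the leading term `s (b - a) n ^ (-s - 1)`, so one further
power of `n` is gained. This is what carries the series past `re s = 0`. -/
theorem norm_hurwitzDiffTerm_le {a b : ℝ} (ha : 0 < a) (hab : a ≤ b) (hb : b ≤ 1) (n : ℕ) {s : ℂ}
    (hs : -1 ≤ s.re) :
    ‖hurwitzDiffTerm a b n s‖
      ≤ ‖s‖ * (b - a) * (‖s + 1‖ * (n + a) ^ (-s.re - 2) * 2) := by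
  rcases eq_or_ne s 0 with rfl | hs0
  · simp [hurwitzDiffTerm]
  have hm : (0 : ℝ) < n + a := by positivity
  -- The term is `h 0 - h 1`, and `h'` is itself a difference of powers at two points at least `n +
  -- a` and at most 2 apart: a second-order mean value estimate.
  set h : ℝ → ℂ := fun t ↦ ((b - a) * t + (n + a) : ℝ) ^ (-s) -
    (b - a) * ((1 * t + (n + 1) : ℝ) : ℂ) ^ (-s)
  have hlin : ∀ c d t : ℝ, 0 < c * t + d → HasDerivAt (fun t : ℝ ↦ ((c * t + d : ℝ) : ℂ) ^ (-s))
      (c • (-s * ((c * t + d : ℝ) : ℂ) ^ (-s - 1))) t := fun c d t ht ↦ by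
    have h1 : HasDerivAt (fun t : ℝ ↦ c * t + d) c t := by
      simpa using ((hasDerivAt_id t).const_mul c).add_const d
    exact (hasDerivAt_ofReal_cpow_const ht.ne' (neg_ne_zero.2 hs0)).scomp t h1
  have hx : ∀ t : ℝ, 0 ≤ t → n + a ≤ (b - a) * t + (n + a) := fun t ht ↦ by
    have := mul_nonneg (sub_nonneg.2 hab) ht
    linarith
  have hd : ∀ t ∈ Set.Icc (0 : ℝ) 1, HasDerivWithinAt h
      (-s * (b - a) * (((((b - a) * t + (n + a) : ℝ) : ℂ) ^ (-(s + 1)))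
        - ((1 * t + (n + 1) : ℝ) : ℂ) ^ (-(s + 1)))) (Set.Icc 0 1) t := fun t ht ↦ by
    have h1 := hlin (b - a) (n + a) t (hm.trans_le (hx t ht.1))
    have h2 := hlin 1 (n + 1) t (by have := ht.1; positivity)
    refine ((h1.sub (h2.const_mul ((b : ℂ) - a))).congr_deriv ?_).hasDerivWithinAt
    simp only [real_smul, neg_add', ofReal_one, ofReal_sub]
    ring
  have := norm_image_sub_le_of_norm_deriv_le_segment_01' hd
    (C := ‖s‖ * (b - a) * (‖s + 1‖ * (n + a) ^ (-s.re - 2) * 2)) fun t ht ↦ ?_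
  · rw [norm_sub_rev] at this
    have he : h 0 - h 1 = hurwitzDiffTerm a b n s := by
      simp only [hurwitzDiffTerm, h]
      push_cast
      ring_nf
    rwa [he] at this
  · have hba : ‖(b : ℂ) - a‖ = b - a := by
      rw [← ofReal_sub, norm_real, Real.norm_of_nonneg (sub_nonneg.2 hab)]
    rw [norm_mul, norm_mul, norm_neg, hba]
    have hB := norm_ofReal_cpow_neg_sub_le hm (hx t ht.1)
      (y := 1 * t + (n + 1)) (by have := ht.1; linarith) (w := s + 1) (by simp; linarith)
    refine mul_le_mul_of_nonneg_left (hB.trans ?_) (by have := sub_nonneg.2 hab; positivity)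
    have he : -(s + 1).re - 1 = -s.re - 2 := by simp; ring
    rw [he]
    refine mul_le_mul_of_nonneg_left ?_ (by positivity)
    have h1 := mul_le_mul_of_nonneg_left ht.2.le (sub_nonneg.2 hab)
    have h2 := mul_nonneg (sub_nonneg.2 hab) ht.1
    have := ht.1
    have := ht.2
    rw [abs_le]
    constructor <;> linarith

theorem hasSum_hurwitzDiffTerm {a b : ℝ} (ha : a ∈ Set.Icc 0 1) (hb : b ∈ Set.Icc 0 1) {s : ℂ}
    (hs : 1 < s.re) :
    HasSum (fun n ↦ hurwitzDiffTerm a b n s)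
      (HurwitzZeta.hurwitzZeta a s - HurwitzZeta.hurwitzZeta b s - (b - a)) := by
  have key : ∀ x ∈ Set.Icc (0 : ℝ) 1, HasSum (fun n : ℕ ↦ ((n + x : ℝ) : ℂ) ^ (-s))
      (HurwitzZeta.hurwitzZeta x s) := fun x hx ↦ by
    simpa [cpow_neg] using HurwitzZeta.hasSum_hurwitzZeta_of_one_lt_re hx hs
  have h1 := key 1 (by simp)
  have h2 := (hasSum_nat_add_iff' 1).2 h1
  have h3 := ((key a ha).sub (key b hb)).sub ((h1.sub h2).mul_left ((b : ℂ) - a))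
  simp only [Finset.range_one, Finset.sum_singleton, CharP.cast_eq_zero, zero_add, ofReal_one,
    one_cpow, sub_sub_cancel, mul_one] at h3
  refine h3.congr_fun fun n ↦ ?_
  simp only [hurwitzDiffTerm]
  push_cast
  ring_nf

/-- A domain around `0` that meets the half-plane `1 < re s`. -/
def hurwitzDiffDomain : Set ℂ := {s | -1 / 2 < s.re} ∩ Metric.ball 0 3

theorem isOpen_hurwitzDiffDomain : IsOpen hurwitzDiffDomain :=
  (isOpen_lt continuous_const continuous_re).inter Metric.isOpen_ball

theorem isPreconnected_hurwitzDiffDomain : IsPreconnected hurwitzDiffDomain :=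
  ((convex_halfSpace_re_gt _).inter (convex_ball _ _)).isPreconnected

theorem zero_mem_hurwitzDiffDomain : (0 : ℂ) ∈ hurwitzDiffDomain := by
  constructor <;> norm_num

theorem norm_hurwitzDiffTerm_le_of_mem {a b : ℝ} (ha : 0 < a) (hab : a ≤ b) (hb : b ≤ 1) (n : ℕ)
    {s : ℂ} (hs : s ∈ hurwitzDiffDomain) :
    ‖hurwitzDiffTerm a b n s‖ ≤ 24 * a ^ (-4 : ℝ) * (1 / |n + a| ^ (3 / 2 : ℝ)) := by
  have hm : (0 : ℝ) < n + a := by positivity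
  have hre : -1 / 2 < s.re := hs.1
  have hn : ‖s‖ < 3 := by simpa using hs.2
  have hre3 : s.re < 3 := (re_le_norm s).trans_lt hn
  have hn1 : ‖s + 1‖ ≤ 4 := (norm_add_le _ _).trans (by simp; linarith)
  have hpow : ((n : ℝ) + a) ^ (-s.re - 2) ≤ a ^ (-4 : ℝ) * (1 / |n + a| ^ (3 / 2 : ℝ)) := by
    -- The surplus exponent `-re s - 1/2` lies in `(-7/2, 0)`, so its power is at most `a ^ (-4)`
    -- because `a ≤ 1`.
    rw [abs_of_pos hm, one_div, ← Real.rpow_neg hm.le,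
      show -s.re - 2 = (-s.re - 1 / 2) + -(3 / 2) by ring, Real.rpow_add hm]
    gcongr
    exact (Real.rpow_le_rpow_of_nonpos ha (by simp) (by linarith)).trans
      (Real.rpow_le_rpow_of_exponent_ge ha (hab.trans hb) (by linarith))
  refine (norm_hurwitzDiffTerm_le ha hab hb n (by linarith)).trans ?_
  have : ‖s‖ * (b - a) ≤ 3 * 1 := by
    gcongr
    linarith
  calc _ ≤ 3 * 1 * (4 * (a ^ (-4 : ℝ) * (1 / |n + a| ^ (3 / 2 : ℝ))) * 2) := by gcongr
    _ = _ := by ring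

theorem hurwitzZeta_sub_hurwitzZeta_eq_tsum {a b : ℝ} (ha : 0 < a) (hab : a ≤ b) (hb : b ≤ 1) :
    Set.EqOn (fun s ↦ HurwitzZeta.hurwitzZeta a s - HurwitzZeta.hurwitzZeta b s)
      (fun s ↦ (b - a) + ∑' n, hurwitzDiffTerm a b n s) hurwitzDiffDomain := by
  have hsum : Summable fun n : ℕ ↦ 24 * a ^ (-4 : ℝ) * (1 / |n + a| ^ (3 / 2 : ℝ)) :=
    ((Real.summable_one_div_nat_add_rpow a (3 / 2)).2 (by norm_num)).mul_left _
  refine AnalyticOnNhd.eqOn_of_preconnected_of_eventuallyEq (𝕜 := ℂ) (z₀ := 2) ?_ ?_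
    isPreconnected_hurwitzDiffDomain ⟨by norm_num, by simp; norm_num⟩ ?_
  · exact fun s _ ↦ (HurwitzZeta.differentiable_hurwitzZeta_sub_hurwitzZeta _ _).analyticAt s
  · refine DifferentiableOn.analyticOnNhd (DifferentiableOn.const_add _ ?_)
      isOpen_hurwitzDiffDomain
    exact differentiableOn_tsum_of_summable_norm hsum
      (fun n s _ ↦ (hasDerivAt_hurwitzDiffTerm ha (ha.trans_le hab) n
        s).differentiableAt.differentiableWithinAt) isOpen_hurwitzDiffDomain
      fun n s hs ↦ norm_hurwitzDiffTerm_le_of_mem ha hab hb n hs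
  · filter_upwards [(isOpen_lt continuous_const continuous_re).mem_nhds
      (show (1 : ℝ) < (2 : ℂ).re by norm_num)] with s hs
    rw [(hasSum_hurwitzDiffTerm ⟨ha.le, hab.trans hb⟩ ⟨(ha.le.trans hab), hb⟩ hs).tsum_eq]
    ring

/-! ### Value and derivative at `s = 0` -/

theorem hurwitzZeta_zero_sub_hurwitzZeta_zero {a b : ℝ} (ha : 0 < a) (hab : a ≤ b) (hb : b ≤ 1) :
    HurwitzZeta.hurwitzZeta a 0 - HurwitzZeta.hurwitzZeta b 0 = b - a := by
  have := hurwitzZeta_sub_hurwitzZeta_eq_tsum ha hab hb zero_mem_hurwitzDiffDomain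
  simpa [hurwitzDiffTerm] using this

theorem tendsto_sum_range_log_sub_log {a b : ℝ} (ha : 0 < a) (hb : 0 < b) :
    Tendsto (fun N : ℕ ↦ ∑ n ∈ Finset.range N, (Real.log (n + b) - Real.log (n + a)
      - (b - a) * (Real.log (n + 2) - Real.log (n + 1)))) atTop
      (𝓝 (Real.log (Real.Gamma a) - Real.log (Real.Gamma b))) := by
  have hlim : ∀ x : ℝ, 0 < x → Tendsto (fun N ↦ Real.BohrMollerup.logGammaSeq x N) atTop
      (𝓝 (Real.log (Real.Gamma x))) := fun x hx ↦ Real.BohrMollerup.tendsto_log_gamma hx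
  -- `logGammaSeq x N` contains `N + 1` logarithms, hence the shift. The correction then telescopes
  -- to `log (N + 2)` where Euler's sequence has `log N`.
  rw [← tendsto_add_atTop_iff_nat 1]
  have hlog : Tendsto (fun N : ℕ ↦ Real.log ((N : ℝ) + 2) - Real.log N) atTop (𝓝 0) := by
    have h1 := Real.tendsto_log_nat_add_one_sub_log
    have h2 := (tendsto_add_atTop_iff_nat 1).2 h1
    have := h1.add h2
    simp only [add_zero] at this
    refine this.congr fun N ↦ ?_
    push_cast
    ring_nf
  have := ((hlim a ha).sub (hlim b hb)).sub (hlog.const_mul (b - a))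
  simp only [mul_zero, sub_zero] at this
  refine this.congr fun N ↦ ?_
  have htel : ∀ N : ℕ, ∑ n ∈ Finset.range N, (Real.log ((n : ℝ) + 2) - Real.log (n + 1))
      = Real.log (N + 1) := fun N ↦ by
    have := Finset.sum_range_sub (fun n : ℕ ↦ Real.log ((n : ℝ) + 1)) N
    simp only [Nat.cast_add, Nat.cast_one, CharP.cast_eq_zero, zero_add, Real.log_one,
      sub_zero] at this
    rw [← this]
    refine Finset.sum_congr rfl fun n _ ↦ ?_
    ring_nf
  rw [Finset.sum_sub_distrib, Finset.sum_sub_distrib, ← Finset.mul_sum, htel]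
  simp only [Real.BohrMollerup.logGammaSeq, add_comm a, add_comm b]
  push_cast
  ring_nf

theorem deriv_hurwitzZeta_sub_hurwitzZeta_zero {a b : ℝ} (ha : 0 < a) (hab : a ≤ b) (hb : b ≤ 1) :
    deriv (fun s ↦ HurwitzZeta.hurwitzZeta a s - HurwitzZeta.hurwitzZeta b s) 0
      = ((Real.log (Real.Gamma a) - Real.log (Real.Gamma b) : ℝ) : ℂ) := by
  have hsum : Summable fun n : ℕ ↦ 24 * a ^ (-4 : ℝ) * (1 / |n + a| ^ (3 / 2 : ℝ)) :=
    ((Real.summable_one_div_nat_add_rpow a (3 / 2)).2 (by norm_num)).mul_left _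
  have hb0 := ha.trans_le hab
  have h := hasSum_deriv_of_summable_norm hsum
    (fun n s _ ↦ (hasDerivAt_hurwitzDiffTerm ha hb0 n
        s).differentiableAt.differentiableWithinAt) isOpen_hurwitzDiffDomain
      (fun n s hs ↦ norm_hurwitzDiffTerm_le_of_mem ha hab hb n hs) zero_mem_hurwitzDiffDomain
  have heq := ((hurwitzZeta_sub_hurwitzZeta_eq_tsum ha hab hb).eventuallyEq_of_mem
    (isOpen_hurwitzDiffDomain.mem_nhds zero_mem_hurwitzDiffDomain)).deriv_eq
  rw [heq, deriv_const_add]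
  refine tendsto_nhds_unique h.tendsto_sum_nat ?_
  refine ((continuous_ofReal.tendsto _).comp (tendsto_sum_range_log_sub_log ha hb0)).congr
    fun N ↦ ?_
  simp only [Function.comp_apply, ofReal_sum]
  refine Finset.sum_congr rfl fun n _ ↦ ?_
  rw [(hasDerivAt_hurwitzDiffTerm ha hb0 n 0).deriv]
  simp only [neg_zero, cpow_zero]
  push_cast
  ring

/-! ### Relations modulo 3 -/

theorem toAddCircle_three_one : ZMod.toAddCircle (1 : ZMod 3) = ((1 / 3 : ℝ) : UnitAddCircle) := by
  simpa using ZMod.toAddCircle_intCast (N := 3) 1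

theorem toAddCircle_three_two : ZMod.toAddCircle (2 : ZMod 3) = ((2 / 3 : ℝ) : UnitAddCircle) := by
  simpa using ZMod.toAddCircle_intCast (N := 3) 2

theorem neg_one_third_unitAddCircle :
    -((1 / 3 : ℝ) : UnitAddCircle) = ((2 / 3 : ℝ) : UnitAddCircle) := by
  rw [← toAddCircle_three_one, ← toAddCircle_three_two, ← map_neg]
  rfl

theorem stdAddChar_three_one :
    ZMod.stdAddChar (1 : ZMod 3) = -1 / 2 + (√3 / 2 : ℝ) * I := by
  have h := ZMod.stdAddChar_coe (N := 3) 1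
  have hcos : Real.cos (2 * Real.pi / 3) = -1 / 2 := by
    rw [show 2 * Real.pi / 3 = Real.pi - Real.pi / 3 by ring, Real.cos_pi_sub,
      Real.cos_pi_div_three]
    norm_num
  have hsin : Real.sin (2 * Real.pi / 3) = √3 / 2 := by
    rw [show 2 * Real.pi / 3 = Real.pi - Real.pi / 3 by ring, Real.sin_pi_sub,
      Real.sin_pi_div_three]
  rw [show 2 * (Real.pi : ℂ) * I * (1 : ℤ) / (3 : ℕ) = ((2 * Real.pi / 3 : ℝ) : ℂ) * I by
    push_cast; ring, exp_mul_I, ← ofReal_cos, ← ofReal_sin, hcos, hsin] at h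
  simpa using h

theorem ofReal_sqrt_three_sq : (√3 : ℂ) ^ 2 = 3 := by
  rw [← ofReal_pow, Real.sq_sqrt (by norm_num)]
  norm_num

theorem stdAddChar_three_two :
    ZMod.stdAddChar (2 : ZMod 3) = -1 / 2 - (√3 / 2 : ℝ) * I := by
  rw [show (2 : ZMod 3) = 1 + 1 by rfl, AddChar.map_add_eq_mul, stdAddChar_three_one]
  push_cast
  linear_combination (√3 : ℂ) ^ 2 / 4 * I_sq - ofReal_sqrt_three_sq / 4

/-- The sine zeta function is the odd part of `expZeta`. Expanding both exponentials over residues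
modulo 3, residue 0 cancels and the others carry `±(ω - ω²) = ±i√3`, with `ω = exp (2πi/3)`. -/
theorem sinZeta_one_third (s : ℂ) :
    HurwitzZeta.sinZeta ((1 / 3 : ℝ) : UnitAddCircle) s = √3 / 2 * 3 ^ (-s) *
      (HurwitzZeta.hurwitzZeta ((1 / 3 : ℝ) : UnitAddCircle) s
        - HurwitzZeta.hurwitzZeta ((2 / 3 : ℝ) : UnitAddCircle) s) := by
  have h1 := ZMod.LFunction_stdAddChar_eq_expZeta (1 : ZMod 3) s (Or.inl (by decide))
  have h2 := ZMod.LFunction_stdAddChar_eq_expZeta (2 : ZMod 3) s (Or.inl (by decide))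
  have huniv : (Finset.univ : Finset (ZMod 3)) = {0, 1, 2} := rfl
  rw [toAddCircle_three_one] at h1
  rw [toAddCircle_three_two] at h2
  simp only [ZMod.LFunction, huniv] at h1 h2
  rw [Finset.sum_insert (by decide), Finset.sum_insert (by decide), Finset.sum_singleton] at h1 h2
  rw [show (1 : ZMod 3) * 0 = 0 by rfl, show (1 : ZMod 3) * 1 = 1 by rfl,
    show (1 : ZMod 3) * 2 = 2 by rfl] at h1
  rw [show (2 : ZMod 3) * 0 = 0 by rfl, show (2 : ZMod 3) * 1 = 2 by rfl,
    show (2 : ZMod 3) * 2 = 1 by rfl] at h2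
  rw [stdAddChar_three_one, stdAddChar_three_two, toAddCircle_three_one,
    toAddCircle_three_two] at h1 h2
  rw [HurwitzZeta.sinZeta_eq, neg_one_third_unitAddCircle, ← h1, ← h2, div_eq_iff (by simp)]
  push_cast
  ring

theorem sum_hurwitzZeta_thirds {s : ℂ} (hs : 1 < s.re) :
    riemannZeta s + HurwitzZeta.hurwitzZeta ((1 / 3 : ℝ) : UnitAddCircle) s
      + HurwitzZeta.hurwitzZeta ((2 / 3 : ℝ) : UnitAddCircle) s = 3 ^ s * riemannZeta s := by
  have h := ZMod.LFunction_eq_LSeries (N := 3) 1 hs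
  have huniv : (Finset.univ : Finset (ZMod 3)) = {0, 1, 2} := rfl
  have h1 : LSeries (fun n : ℕ ↦ (1 : ZMod 3 → ℂ) n) s = riemannZeta s :=
    LSeries_one_eq_riemannZeta hs
  rw [h1, ZMod.LFunction, huniv, Finset.sum_insert (by decide), Finset.sum_insert (by decide),
    Finset.sum_singleton, toAddCircle_three_one, toAddCircle_three_two, map_zero,
    HurwitzZeta.hurwitzZeta_zero] at h
  have h3 : (3 : ℂ) ^ s * 3 ^ (-s) = 1 := by
    rw [← cpow_add _ _ (by norm_num)]; simp
  simp only [Pi.one_apply, one_mul, Nat.cast_ofNat] at h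
  linear_combination 3 ^ s * h - h3 * (riemannZeta s
    + HurwitzZeta.hurwitzZeta ((1 / 3 : ℝ) : UnitAddCircle) s
      + HurwitzZeta.hurwitzZeta ((2 / 3 : ℝ) : UnitAddCircle) s)

/-! ### The difference: functional equation and derivative at `s = 1` -/

/-- The entire function `ζ(s, 1/3) - ζ(s, 2/3)`. -/
noncomputable def hurwitzThirdsDiff (s : ℂ) : ℂ :=
  HurwitzZeta.hurwitzZeta ((1 / 3 : ℝ) : UnitAddCircle) s
    - HurwitzZeta.hurwitzZeta ((2 / 3 : ℝ) : UnitAddCircle) s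

theorem differentiable_hurwitzThirdsDiff : Differentiable ℂ hurwitzThirdsDiff :=
  HurwitzZeta.differentiable_hurwitzZeta_sub_hurwitzZeta _ _

theorem hurwitzThirdsDiff_one_sub {s : ℂ} (hs : ∀ n : ℕ, s ≠ -n) :
    hurwitzThirdsDiff (1 - s) = 2 * √3 * (((2 * Real.pi) ^ (-s) * 3 ^ (-s) * Gamma s)
      * sin (Real.pi * s / 2) * hurwitzThirdsDiff s) := by
  have h := HurwitzZeta.hurwitzZetaOdd_one_sub ((1 / 3 : ℝ) : UnitAddCircle) hs
  rw [HurwitzZeta.hurwitzZetaOdd_eq, neg_one_third_unitAddCircle, sinZeta_one_third] at h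
  simp only [hurwitzThirdsDiff]
  linear_combination 2 * h

theorem hurwitzThirdsDiff_zero : hurwitzThirdsDiff 0 = 1 / 3 := by
  have := hurwitzZeta_zero_sub_hurwitzZeta_zero (a := 1 / 3) (b := 2 / 3) (by norm_num)
    (by norm_num) (by norm_num)
  rw [hurwitzThirdsDiff, this]
  norm_num

theorem hurwitzThirdsDiff_one : hurwitzThirdsDiff 1 = Real.pi * √3 / 3 := by
  have h := hurwitzThirdsDiff_one_sub (s := 1) fun n hn ↦ by
    have := congrArg re hn
    simp at this
    linarith [n.cast_nonneg (α := ℝ)]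
  have hπ : (Real.pi : ℂ) ≠ 0 := by exact_mod_cast Real.pi_ne_zero
  rw [sub_self, hurwitzThirdsDiff_zero, mul_one, sin_pi_div_two, Gamma_one, cpow_neg_one,
    cpow_neg_one] at h
  field_simp at h
  linear_combination (-√3 : ℂ) / 3 * h - hurwitzThirdsDiff 1 / 3 * ofReal_sqrt_three_sq

theorem log_Gamma_two_thirds : Real.log (Real.Gamma (2 / 3)) =
    Real.log (2 * Real.pi) - Real.log 3 / 2 - Real.log (Real.Gamma (1 / 3)) := by
  have h := Real.Gamma_mul_Gamma_one_sub (1 / 3)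
  have h1 : Real.Gamma (1 / 3) ≠ 0 := (Real.Gamma_pos_of_pos (by norm_num)).ne'
  have h2 : Real.Gamma (2 / 3) ≠ 0 := (Real.Gamma_pos_of_pos (by norm_num)).ne'
  have h3 : √(3 : ℝ) ≠ 0 := by positivity
  rw [show (1 : ℝ) - 1 / 3 = 2 / 3 by norm_num, show Real.pi * (1 / 3) = Real.pi / 3 by ring,
    Real.sin_pi_div_three, div_div_eq_mul_div, mul_comm Real.pi] at h
  have h4 := congrArg Real.log h
  rw [Real.log_mul h1 h2, Real.log_div (by positivity) h3, Real.log_sqrt (by norm_num)] at h4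
  linarith

theorem deriv_hurwitzThirdsDiff_zero : deriv hurwitzThirdsDiff 0 =
    ((2 * Real.log (Real.Gamma (1 / 3)) - Real.log (2 * Real.pi) + Real.log 3 / 2 : ℝ) : ℂ) := by
  refine (deriv_hurwitzZeta_sub_hurwitzZeta_zero (a := 1 / 3) (b := 2 / 3) (by norm_num)
    (by norm_num) (by norm_num)).trans ?_
  rw [log_Gamma_two_thirds]
  congr 1
  ring

theorem deriv_hurwitzThirdsDiff_one : deriv hurwitzThirdsDiff 1 =
    ((-(Real.pi / √3 * (6 * Real.log (Real.Gamma (1 / 3)) + 1 / 2 * Real.log 3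
      - (Real.eulerMascheroniConstant + 4 * Real.log (2 * Real.pi)))) : ℝ) : ℂ) := by
  have hπ : (Real.pi : ℂ) ≠ 0 := by exact_mod_cast Real.pi_ne_zero
  have hcp : ∀ c : ℝ, 0 < c → HasDerivAt (fun s : ℂ ↦ (c : ℂ) ^ (-s))
      (-((c : ℂ)⁻¹ * Real.log c)) 1 := fun c hc ↦ by
    have := (hasDerivAt_neg (1 : ℂ)).const_cpow (c := (c : ℂ))
      (Or.inl (by exact_mod_cast hc.ne'))
    rw [cpow_neg_one, ← ofReal_log hc.le] at this
    exact this.congr_deriv (by ring)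
  -- The sine is stationary at `s = 1`, so only the powers, `Γ` (whence `γ`) and `D` contribute to
  -- the logarithmic derivative.
  have hsin : HasDerivAt (fun s : ℂ ↦ sin (Real.pi * s / 2)) 0 1 := by
    have := (((hasDerivAt_id (1 : ℂ)).const_mul (Real.pi : ℂ)).div_const 2).csin
    simpa using this
  have hR := ((((hcp (2 * Real.pi) (by positivity)).mul (hcp 3 (by norm_num))).mul
    hasDerivAt_Gamma_one).mul hsin).mul (differentiable_hurwitzThirdsDiff 1).hasDerivAt
  have hL : HasDerivAt (fun s ↦ hurwitzThirdsDiff (1 - s)) (-deriv hurwitzThirdsDiff 0) 1 := by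
    have h0 : HasDerivAt hurwitzThirdsDiff (deriv hurwitzThirdsDiff 0) (1 - 1) := by
      rw [sub_self]
      exact (differentiable_hurwitzThirdsDiff 0).hasDerivAt
    exact (h0.comp_const_sub 1 1)
  have heq : (fun s ↦ hurwitzThirdsDiff (1 - s)) =ᶠ[𝓝 1] fun s ↦ 2 * √3 *
      ((((2 * Real.pi : ℝ) : ℂ) ^ (-s) * ((3 : ℝ) : ℂ) ^ (-s) * Gamma s)
      * sin (Real.pi * s / 2) * hurwitzThirdsDiff s) := by
    filter_upwards [(isOpen_lt continuous_const continuous_re).mem_nhds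
      (show (0 : ℝ) < (1 : ℂ).re by norm_num)] with s hs
    rw [hurwitzThirdsDiff_one_sub]
    · push_cast
      rfl
    · rintro n rfl
      simp at hs
      linarith [n.cast_nonneg (α := ℝ)]
  have h := (hL.congr_of_eventuallyEq heq.symm).unique (hR.const_mul (2 * (√3 : ℂ)))
  simp only [Pi.mul_apply, mul_one, sin_pi_div_two, Gamma_one, cpow_neg_one, mul_zero, add_zero,
    hurwitzThirdsDiff_one, deriv_hurwitzThirdsDiff_zero] at h
  have h3 : (√3 : ℂ) ≠ 0 := by
    intro h0
    have := ofReal_sqrt_three_sq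
    simp [h0] at this
  push_cast at h ⊢
  set D := deriv hurwitzThirdsDiff 1
  set A := (Real.log (Real.Gamma (1 / 3)) : ℂ)
  set B := (Real.log (2 * Real.pi) : ℂ)
  set C := (Real.log 3 : ℂ)
  set g := (Real.eulerMascheroniConstant : ℂ)
  field_simp at h ⊢
  linear_combination -h / 3 + 2 / 3 * Real.pi * (B + C + g) * ofReal_sqrt_three_sq

/-! ### From regular parts to Stieltjes constants -/

theorem hurwitzRegularPart_of_ne {u : ℝ} (hu : u ≤ 1) {s : ℂ} (hs : s ≠ 1) :
    hurwitzRegularPart u s = HurwitzZeta.hurwitzZeta (u : UnitAddCircle) s - 1 / (s - 1) := by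
  simp [hurwitzRegularPart, hs, hurwitzZetaReal_of_le_one s hu]

theorem hurwitzRegularPart_one_of_ne {s : ℂ} (hs : s ≠ 1) :
    hurwitzRegularPart 1 s = riemannZeta s - 1 / (s - 1) := by
  simp [hurwitzRegularPart, hs, hurwitzZetaReal_one s]

theorem hurwitzRegularPart_one_one :
    hurwitzRegularPart 1 1 = Real.eulerMascheroniConstant := by
  simp only [hurwitzRegularPart, Function.update_self, hurwitzZetaReal_one]
  exact tendsto_riemannZeta_sub_one_div.limUnder_eq

theorem generalisedStieltjes_one (u : ℝ) :
    generalisedStieltjes 1 u = -deriv (hurwitzRegularPart u) 1 := by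
  simp [generalisedStieltjes, iteratedDeriv_one]

theorem generalisedStieltjes_one_third_sub_two_thirds :
    generalisedStieltjes 1 (1 / 3) - generalisedStieltjes 1 (2 / 3)
      = -deriv hurwitzThirdsDiff 1 := by
  have d1 := differentiable_hurwitzRegularPart (u := 1 / 3) (by norm_num)
  have d2 := differentiable_hurwitzRegularPart (u := 2 / 3) (by norm_num)
  have h : hurwitzThirdsDiff = hurwitzRegularPart (1 / 3) - hurwitzRegularPart (2 / 3) := by
    -- Off `s = 1` the poles cancel; continuity settles the point `1` itself.
    refine Continuous.ext_on (dense_compl_singleton 1) differentiable_hurwitzThirdsDiff.continuous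
      (d1.sub d2).continuous fun s hs ↦ ?_
    rw [Pi.sub_apply, hurwitzRegularPart_of_ne (by norm_num) hs,
      hurwitzRegularPart_of_ne (by norm_num) hs, hurwitzThirdsDiff]
    ring
  rw [h, deriv_sub (d1 1) (d2 1), generalisedStieltjes_one, generalisedStieltjes_one]
  ring

/-- The regular part of `ζ(s) + ζ(s, 1/3) + ζ(s, 2/3) - 3 ^ s * ζ(s)`. -/
noncomputable def hurwitzThirdsDefect (s : ℂ) : ℂ :=
  hurwitzRegularPart 1 s + hurwitzRegularPart (1 / 3) s + hurwitzRegularPart (2 / 3) s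
    - 3 ^ s * hurwitzRegularPart 1 s

theorem hasDerivAt_three_cpow (s : ℂ) :
    HasDerivAt (fun s : ℂ ↦ (3 : ℂ) ^ s) (3 ^ s * Real.log 3) s := by
  have := (hasDerivAt_id s).const_cpow (c := (3 : ℂ)) (Or.inl (by norm_num))
  simpa [ofReal_log] using this

theorem differentiable_hurwitzThirdsDefect : Differentiable ℂ hurwitzThirdsDefect := by
  have d0 := differentiable_hurwitzRegularPart (u := 1) (by norm_num)
  have d1 := differentiable_hurwitzRegularPart (u := 1 / 3) (by norm_num)
  have d2 := differentiable_hurwitzRegularPart (u := 2 / 3) (by norm_num)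
  exact ((d0.add d1).add d2).sub
    (Differentiable.mul (fun s ↦ (hasDerivAt_three_cpow s).differentiableAt) d0)

theorem sub_one_mul_hurwitzThirdsDefect (s : ℂ) :
    (s - 1) * hurwitzThirdsDefect s = 3 ^ s - 3 := by
  have hd1 : Differentiable ℂ fun s ↦ (s - 1) * hurwitzThirdsDefect s :=
    (differentiable_id.sub_const 1).mul differentiable_hurwitzThirdsDefect
  have hd2 : Differentiable ℂ fun s : ℂ ↦ (3 : ℂ) ^ s - 3 :=
    Differentiable.sub_const (fun s ↦ (hasDerivAt_three_cpow s).differentiableAt) 3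
  refine congrFun (AnalyticOnNhd.eq_of_eventuallyEq (𝕜 := ℂ) (z₀ := 2)
    (fun s _ ↦ hd1.analyticAt s) (fun s _ ↦ hd2.analyticAt s) ?_) s
  filter_upwards [(isOpen_lt continuous_const continuous_re).mem_nhds
    (show (1 : ℝ) < (2 : ℂ).re by norm_num)] with s hs
  have hs1 : s ≠ 1 := by
    rintro rfl
    simp at hs
  have hs2 : s - 1 ≠ 0 := sub_ne_zero.2 hs1
  have h := sum_hurwitzZeta_thirds hs
  rw [hurwitzThirdsDefect, hurwitzRegularPart_one_of_ne hs1,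
    hurwitzRegularPart_of_ne (by norm_num) hs1, hurwitzRegularPart_of_ne (by norm_num) hs1]
  field_simp
  linear_combination (s - 1) * h

theorem deriv_hurwitzThirdsDefect_one :
    deriv hurwitzThirdsDefect 1 = 3 / 2 * (Real.log 3 : ℂ) ^ 2 := by
  have hD := differentiable_hurwitzThirdsDefect
  -- Differentiating `(s - 1) E(s) = 3 ^ s - 3` twice avoids dividing by `s - 1`; at `1` it reads `2
  -- E'(1) = 3 log² 3`.
  have h1 : (fun s ↦ hurwitzThirdsDefect s + (s - 1) * deriv hurwitzThirdsDefect s)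
      = fun s ↦ (3 : ℂ) ^ s * Real.log 3 := by
    funext s
    have hl := ((hasDerivAt_id s).sub_const 1).mul (hD s).hasDerivAt
    have hr := (hasDerivAt_three_cpow s).sub_const 3
    rw [← funext sub_one_mul_hurwitzThirdsDefect] at hr
    simpa using hl.unique hr
  have hl := (hD 1).hasDerivAt.add
    (((hasDerivAt_id (1 : ℂ)).sub_const 1).mul (hD.deriv 1).hasDerivAt)
  have hr := (hasDerivAt_three_cpow 1).mul_const (Real.log 3 : ℂ)
  rw [← h1] at hr
  have h := hl.unique hr
  simp only [id, sub_self, zero_mul, add_zero, one_mul, cpow_one] at h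
  linear_combination h / 2

theorem generalisedStieltjes_one_third_add_two_thirds :
    generalisedStieltjes 1 (1 / 3) + generalisedStieltjes 1 (2 / 3) =
        2 * stieltjesConstant 1
          - ((3 * Real.eulerMascheroniConstant * Real.log 3
            + 3 / 2 * Real.log 3 ^ 2 : ℝ) : ℂ) := by
  have d0 := (differentiable_hurwitzRegularPart (u := 1) (by norm_num) 1).hasDerivAt
  have d1 := (differentiable_hurwitzRegularPart (u := 1 / 3) (by norm_num) 1).hasDerivAt
  have d2 := (differentiable_hurwitzRegularPart (u := 2 / 3) (by norm_num) 1).hasDerivAt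
  have h := (((d0.add d1).add d2).sub ((hasDerivAt_three_cpow 1).mul d0)).unique
    (differentiable_hurwitzThirdsDefect 1).hasDerivAt
  rw [deriv_hurwitzThirdsDefect_one, hurwitzRegularPart_one_one, cpow_one] at h
  rw [stieltjesConstant, generalisedStieltjes_one, generalisedStieltjes_one,
    generalisedStieltjes_one]
  push_cast
  linear_combination -h

theorem mainTheorem6 :
    -- the difference
    generalisedStieltjes 1 (1 / 3) - generalisedStieltjes 1 (2 / 3) =
        ((-(Real.pi / (2 * √3)) *
          (2 * Real.eulerMascheroniConstant - Real.log 3 + 8 * Real.log (2 * Real.pi)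
            - 12 * Real.log (Real.Gamma (1 / 3))) : ℝ) : ℂ) ∧
    -- the difference in the form that comes from Shail's series
    generalisedStieltjes 1 (1 / 3) - generalisedStieltjes 1 (2 / 3) =
        ((Real.pi / √3 *
          (6 * Real.log (Real.Gamma (1 / 3)) + 1 / 2 * Real.log 3
            - (Real.eulerMascheroniConstant + 4 * Real.log (2 * Real.pi))) : ℝ) : ℂ) ∧
    -- the sum
    generalisedStieltjes 1 (1 / 3) + generalisedStieltjes 1 (2 / 3) =
        2 * stieltjesConstant 1
          - ((3 * Real.eulerMascheroniConstant * Real.log 3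
            + 3 / 2 * Real.log 3 ^ 2 : ℝ) : ℂ) ∧
    -- the two values
    generalisedStieltjes 1 (1 / 3) =
        stieltjesConstant 1
          + ((-(3 / 2) * Real.eulerMascheroniConstant * Real.log 3 - 3 / 4 * Real.log 3 ^ 2
            - Real.pi / (4 * √3) *
              (2 * Real.eulerMascheroniConstant - Real.log 3 + 8 * Real.log (2 * Real.pi)
                - 12 * Real.log (Real.Gamma (1 / 3))) : ℝ) : ℂ) ∧
    generalisedStieltjes 1 (2 / 3) =
        stieltjesConstant 1
          + ((-(3 / 2) * Real.eulerMascheroniConstant * Real.log 3 - 3 / 4 * Real.log 3 ^ 2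
            + Real.pi / (4 * √3) *
              (2 * Real.eulerMascheroniConstant - Real.log 3 + 8 * Real.log (2 * Real.pi)
                - 12 * Real.log (Real.Gamma (1 / 3))) : ℝ) : ℂ) := by

  have hsub := generalisedStieltjes_one_third_sub_two_thirds
  rw [deriv_hurwitzThirdsDiff_one, ← ofReal_neg, neg_neg] at hsub
  have hadd := generalisedStieltjes_one_third_add_two_thirds
  refine ⟨?_, hsub, hadd, ?_, ?_⟩
  · rw [hsub]
    congr 1
    field_simp
    ring
  · push_cast at hsub hadd ⊢
    linear_combination (hsub + hadd) / 2
  · push_cast at hsub hadd ⊢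
    linear_combination (hadd - hsub) / 2
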